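/- Let $\Gamma\subset \mathrm{PSL}_2(\mathbb R)$ be a Fuchsian group of the first kind (a discrete subgroup for which every point of $\mathbb R\cup\{\infty\}$ is a limit of an orbit $\Gamma z$ with $z\in\mathbb H$) that has a cusp $\mathfrak a$. Let $\sigma_{\mathfrak a}\in \mathrm{SL}_2(\mathbb R)$ be a scaling matrix for $\mathfrak a$: $\sigma_{\mathfrak a}\infty=\mathfrak a$ and $\sigma_{\mathfrak a}^{-1}\Gamma_{\mathfrak a}\sigma_{\mathfrak a}=\left\{\pm\begin{pmatrix}1&m\\0&1\end{pmatrix} : m\in\mathbb Z\right\}$, where $\Gamma_{\mathfrak a}$ is the stabilizer of $\mathfrak a$ in $\Gamma$. Let $k>2$ be an even integer, and write $j(g,z)=cz+d$ if $(c\ d)$ is the bottom row of $g$. For $z\in\mathbb H$, $\tau\in\mathbb H\cup\mathbb R$ and $s\in\mathbb C$ consider the series $$\Omega_{\mathfrak a}(z,\tau;s,k)=\sum_{\gamma\in\Gamma}\frac{1}{(\sigma_{\mathfrak a}^{-1}\gamma z-\overline{\tau})^{s}\, j(\sigma_{\mathfrak a}^{-1}\gamma,z)^{k}},$$ where $w^s=e^{s\log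 w}$ with the principal branch of the logarithm. (a) The series converges absolutely for all $z\in\mathbb H$, and its convergence (also that of the series of absolute values) is uniform for $(z,s)$ in compact subsets of $\mathbb H\times D$, in each of the following cases: (i) $\tau\in\mathbb H$ and $D=\{s : 1<\mathrm{Re}(s)\}$; (ii) $\tau\in\mathbb R$ and $D=\{s : 1<\mathrm{Re}(s)<k/2\}$; (iii) $\tau\in\mathbb R$, $\sigma_{\mathfrak a}\tau$ is a cusp of $\Gamma$, and $D=\{s : 1<\mathrm{Re}(s)<k-1\}$. (b) In each of these cases, for every fixed $s\in D$ (with moreover $\mathrm{Re}(s)<k+1$ in case (i)), the function $z\mapsto\Omega_{\mathfrak a}(z,\tau;s,k)$ is a holomorphic cusp form of weight $k$ for $\Gamma$. -/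

import Mathlib

open UpperHalfPlane MatrixGroups ComplexConjugate

namespace CuspKernel

noncomputable section

/-- The full preimage in `SL(2, ℝ)` of a subgroup `Γ` of `PSL(2, ℝ)`. -/
def liftSL (Γ : Subgroup PSL(2, ℝ)) : Subgroup SL(2, ℝ) :=
  Γ.comap (QuotientGroup.mk' (Subgroup.center SL(2, ℝ)))

/-- The full preimage in `SL(2, ℝ)`, seen inside `GL(2, ℝ)`: Mathlib's notions of cusp and cusp form
are stated for such subgroups. -/
def liftGL (Γ : Subgroup PSL(2, ℝ)) : Subgroup (GL (Fin 2) ℝ) :=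
  (liftSL Γ).map Matrix.SpecialLinearGroup.toGL

/-- The set of boundary points `x ∈ ℝ ∪ {∞}` that are limits of an orbit `Γ z` with `z ∈ ℍ`.
The limit is taken on the Riemann sphere `ℂ ∪ {∞}`; as `x` does not lie on the orbit, being in
its closure is the same as being a limit of points of the orbit. -/
def limitSet (Γ : Subgroup PSL(2, ℝ)) : Set (OnePoint ℝ) :=
  {x | ∃ z : ℍ, x.map ((↑) : ℝ → ℂ) ∈
    closure (Set.range fun g : liftSL Γ ↦ (((g : SL(2, ℝ)) • z : ℍ) : OnePoint ℂ))}

/-- A Fuchsian group of the first kind: a discrete subgroup of `PSL(2, ℝ)` for which every boundary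
point of `ℍ` is a limit point. (A subgroup of `PSL(2, ℝ)` is discrete iff its preimage in
`SL(2, ℝ)` under the two-to-one covering is.) -/
structure IsFuchsianFirstKind (Γ : Subgroup PSL(2, ℝ)) : Prop where
  discrete : DiscreteTopology (liftSL Γ)
  limitSet_eq : limitSet Γ = Set.univ

/-- `c ∈ ℝ ∪ {∞}` is a cusp of `Γ`: it is fixed by a parabolic element of `Γ`. -/
def IsCuspOf (Γ : Subgroup PSL(2, ℝ)) (c : OnePoint ℝ) : Prop :=
  IsCusp c (liftGL Γ)

/-- `σ` is a scaling matrix for the cusp `a` of `Γ`: `σ ∞ = a`, and conjugation by `σ⁻¹` carries the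
stabilizer of `a` in `Γ` onto the group of the matrices `± (1 m; 0 1)`, `m ∈ ℤ`. -/
structure IsScalingMatrix (Γ : Subgroup PSL(2, ℝ)) (a : OnePoint ℝ) (σ : SL(2, ℝ)) : Prop where
  map_infty : (σ : GL (Fin 2) ℝ) • (OnePoint.infty : OnePoint ℝ) = a
  conj_stabilizer :
    {h : SL(2, ℝ) | ∃ g ∈ liftSL Γ, (g : GL (Fin 2) ℝ) • a = a ∧ h = σ⁻¹ * g * σ} =
      {h : SL(2, ℝ) | ∃ m : ℤ, (h : Matrix (Fin 2) (Fin 2) ℝ) = !![1, (m : ℝ); 0, 1] ∨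
        (h : Matrix (Fin 2) (Fin 2) ℝ) = -!![1, (m : ℝ); 0, 1]}

/-- The expression `1 / ((h z - τ̄)^s j(h, z)^k)` for a matrix `h`, where `j((a b; c d), z) = c z + d`.
When `0 ≤ Im τ` the base `h z - τ̄` lies in the upper half-plane, and its power is formed with the
principal branch of the logarithm. -/
def matrixTerm (h : SL(2, ℝ)) (k : ℤ) (τ : ℂ) (z : ℍ) (s : ℂ) : ℂ :=
  1 / ((((h • z : ℍ) : ℂ) - conj τ) ^ s * denom (h : GL (Fin 2) ℝ) z ^ k)

/-- The term `1 / ((σ⁻¹ γ z - τ̄)^s j(σ⁻¹ γ, z)^k)` of an element `γ` of `PSL(2, ℝ)`, computed with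
a matrix that represents `γ`. For even `k` the choice is immaterial: see `omegaTerm_mk`. -/
def omegaTerm (σ : SL(2, ℝ)) (k : ℤ) (τ : ℂ) (γ : PSL(2, ℝ)) (z : ℍ) (s : ℂ) : ℂ :=
  matrixTerm (σ⁻¹ * Quotient.out γ) k τ z s

theorem omegaTerm_mk (σ : SL(2, ℝ)) {k : ℤ} (hk : Even k) (τ : ℂ) (g : SL(2, ℝ)) (z : ℍ) (s : ℂ) :
    omegaTerm σ k τ (g : PSL(2, ℝ)) z s = matrixTerm (σ⁻¹ * g) k τ z s := by
  have h1 : ((Quotient.out (g : PSL(2, ℝ)) : SL(2, ℝ)) : PSL(2, ℝ)) = (g : PSL(2, ℝ)) :=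
    Quotient.out_eq _
  rw [QuotientGroup.eq, Matrix.SpecialLinearGroup.mem_center_iff] at h1
  obtain ⟨r, hr, hr'⟩ := h1
  have hr2 : r = 1 ∨ r = -1 := by simpa using hr
  have key : g = Quotient.out (g : PSL(2, ℝ)) ∨ g = -Quotient.out (g : PSL(2, ℝ)) := by
    rcases hr2 with rfl | rfl
    · left
      have : (Quotient.out (g : PSL(2, ℝ)))⁻¹ * g = 1 := by
        apply Subtype.ext; rw [← hr']; simp
      exact (inv_mul_eq_one.mp this).symm
    · right
      have : (Quotient.out (g : PSL(2, ℝ)))⁻¹ * g = -1 := by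
        apply Subtype.ext; rw [← hr']; ext i j; fin_cases i <;> fin_cases j <;> simp
      rw [inv_mul_eq_iff_eq_mul] at this
      simpa using this
  have hneg : ∀ h : SL(2, ℝ), matrixTerm (-h) k τ z s = matrixTerm h k τ z s := by
    intro h
    have hc : ((-h : SL(2, ℝ)) : GL (Fin 2) ℝ) = -(h : GL (Fin 2) ℝ) := by
      ext i j; simp
    have hs : (-h) • z = h • z := by
      change ((-h : SL(2, ℝ)) : GL (Fin 2) ℝ) • z = (h : GL (Fin 2) ℝ) • z
      rw [hc, UpperHalfPlane.neg_smul]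
    rw [matrixTerm, matrixTerm, hs, hc, denom_neg, hk.neg_zpow]
  unfold omegaTerm
  rcases key with h | h
  · rw [← h]
  · conv_rhs => rw [h, mul_neg, hneg]

/-- The series `Ω(z, τ; s, k) = ∑_{γ ∈ Γ} (σ⁻¹ γ z - τ̄)^{-s} j(σ⁻¹ γ, z)^{-k}`. -/
def Omega (Γ : Subgroup PSL(2, ℝ)) (σ : SL(2, ℝ)) (k : ℤ) (τ : ℂ) (z : ℍ) (s : ℂ) : ℂ :=
  ∑' γ : Γ, omegaTerm σ k τ γ z s

/-- The series `Ω(z, τ; s, k)` converges absolutely for all `z ∈ ℍ` and all `s ∈ D`, and it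
converges uniformly, as does the series of the absolute values, for `(z, s)` in any compact subset
of `ℍ × D`. -/
structure ConvergesAbsolutelyUniformly (Γ : Subgroup PSL(2, ℝ)) (σ : SL(2, ℝ)) (k : ℤ) (τ : ℂ)
    (D : Set ℂ) : Prop where
  absolutely : ∀ z : ℍ, ∀ s ∈ D, Summable fun γ : Γ ↦ ‖omegaTerm σ k τ γ z s‖
  uniformly : ∀ K : Set (ℍ × ℂ), IsCompact K → K ⊆ Set.univ ×ˢ D →
    HasSumUniformlyOn (fun (γ : Γ) (p : ℍ × ℂ) ↦ omegaTerm σ k τ γ p.1 p.2)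
      (fun p ↦ Omega Γ σ k τ p.1 p.2) K
  uniformly_norm : ∀ K : Set (ℍ × ℂ), IsCompact K → K ⊆ Set.univ ×ˢ D →
    HasSumUniformlyOn (fun (γ : Γ) (p : ℍ × ℂ) ↦ ‖omegaTerm σ k τ γ p.1 p.2‖)
      (fun p ↦ ∑' γ : Γ, ‖omegaTerm σ k τ γ p.1 p.2‖) K

/-- `F` is a holomorphic cusp form of weight `k` for `Γ`. -/
def IsCuspFormFor (Γ : Subgroup PSL(2, ℝ)) (k : ℤ) (F : ℍ → ℂ) : Prop :=
  ∃ f : CuspForm (liftGL Γ) k, ∀ z : ℍ, f z = F z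

end

end CuspKernel

namespace CuspKernel

noncomputable section

open Filter Topology
open scoped ModularForm

/-! Put `w = σ⁻¹γz`, `κ = k/2`, `t = Re τ`. Since `|j(σ⁻¹γ, z)|² = Im z / Im w`, a term is at most
`e^{π|Im s|} (Im z)^{-κ} (Im w)^κ |w - τ̄|^{-Re s}`. Everything thus rests on orbit sums of `weight
κ r t w = (Im w)^κ |w - t|^{-r}`.

The cusp bounds the heights of the points `w` (`exists_im_orbit_le`). Cut the strip so obtained into
boxes of bounded hyperbolic diameter, each box of height comparable to its distance from the real
line. By discreteness a box holds a bounded number of orbit points, so the sum is compared with `∑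
e^{-m(κ-r)} (1+|n|)^{-r}`, which is finite for `1 < r < κ` (`summable_weight_orbit`). If `σt` is a
cusp, the orbit also avoids a horoball at `t`, and trading powers of `|w - t|` for powers of `Im w`
extends the range to `r < 2κ - 1`. For `τ` in the upper half-plane `|w - τ̄|` is bounded below, so
the exponent may be lowered into the basic range. `IsMajorized` records the outcome in all three
cases.

The weight changes by a bounded factor over bounded hyperbolic distance, which gives the Weierstrass
test on compact sets, hence uniform convergence and holomorphy. Modularity is a reindexing of the
series. At a cusp, periodicity reduces the question to the imaginary axis, where each majorant
decreases to zero with the height; dominated convergence finishes (`isZeroAt_Omega`). -/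

/-! ### Discreteness and the heights of orbits. -/

theorem finite_dist_smul_le (G : Subgroup SL(2, ℝ)) [DiscreteTopology G] (z : ℍ) (R : ℝ) :
    {g : G | dist (g • z) z ≤ R}.Finite := by
  refine (ProperlyDiscontinuousSMul.finite_disjoint_inter_image (Γ := G)
    (isCompact_singleton (x := z)) (isCompact_closedBall z R)).subset fun g hg ↦ ?_
  exact ⟨g • z, ⟨z, rfl, rfl⟩, hg⟩

theorem exists_pos_le_dist_smul (G : Subgroup SL(2, ℝ)) [DiscreteTopology G] (z : ℍ) :
    ∃ δ > 0, ∀ g : G, g • z ≠ z → δ ≤ dist (g • z) z := by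
  have hfin : {g : G | dist (g • z) z ≤ 1 ∧ g • z ≠ z}.Finite :=
    (finite_dist_smul_le G z 1).subset fun g hg ↦ hg.1
  rcases Set.eq_empty_or_nonempty {g : G | dist (g • z) z ≤ 1 ∧ g • z ≠ z} with he | hne
  · refine ⟨1, one_pos, fun g hg ↦ ?_⟩
    by_contra! h
    have : g ∈ {g : G | dist (g • z) z ≤ 1 ∧ g • z ≠ z} := ⟨h.le, hg⟩
    simp [he] at this
  · obtain ⟨g₀, hg₀, hmin⟩ := Set.exists_min_image _ (fun g : G ↦ dist (g • z) z) hfin hne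
    refine ⟨dist (g₀ • z) z, dist_pos.mpr hg₀.2, fun g hg ↦ ?_⟩
    rcases le_or_gt (dist (g • z) z) 1 with h | h
    · exact hmin g ⟨h, hg⟩
    · exact hg₀.1.trans h.le

/-- If `G` contains an element that `h` conjugates to a nontrivial translation, the heights of the
points of `h⁻¹ G z` are bounded. -/
theorem exists_im_orbit_le (G : Subgroup SL(2, ℝ)) [DiscreteTopology G] (h : SL(2, ℝ)) {x : ℝ}
    (hx : x ≠ 0) {p : SL(2, ℝ)} (hp : p ∈ G) (hph : ∀ z : ℍ, p • h • z = h • (x +ᵥ z)) (z : ℍ) :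
    ∃ V > 0, ∀ g ∈ G, (h⁻¹ • g • z).im ≤ V := by
  obtain ⟨δ, hδ, hmin⟩ := exists_pos_le_dist_smul G z
  refine ⟨|x| / δ, by positivity, fun g hg ↦ ?_⟩
  set w := h⁻¹ • g • z with hw
  have hgz : g • z = h • w := by rw [hw, smul_inv_smul]
  -- The conjugate `g⁻¹pg` moves `z` exactly as far as translation by `x` moves `w`, which is at
  -- most `|x| / Im w`. Discreteness bounds this displacement below by `δ`.
  let q : G := ⟨g⁻¹ * p * g, G.mul_mem (G.mul_mem (G.inv_mem hg) hp) hg⟩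
  have hdist : dist (q • z) z = dist (x +ᵥ w) w := by
    have hq : q • z = g⁻¹ • p • g • z := by
      change (g⁻¹ * p * g) • z = _
      simp [mul_smul]
    rw [hq, ← dist_smul g, smul_inv_smul, hgz, hph, dist_smul]
  have hne : q • z ≠ z := by
    rw [← dist_pos, hdist, dist_pos]
    intro he
    have := congrArg UpperHalfPlane.re he
    simp at this
    exact hx this
  have h1 := hmin q hne
  rw [hdist] at h1
  have h2 := dist_le_dist_coe_div_sqrt (x +ᵥ w) w
  have h3 : dist ((x +ᵥ w : ℍ) : ℂ) w = |x| := by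
    simp [dist_eq_norm]
  rw [h3, vadd_im, Real.sqrt_mul_self w.im_pos.le] at h2
  rw [le_div_iff₀ hδ]
  have := (le_div_iff₀ w.im_pos).mp (h1.trans h2)
  linarith

/-- Transfers summability from boxes to orbit points, given a uniform bound on the number of points
in a box. -/
theorem summable_comp_of_fiber_card_le {α β : Type*} [DecidableEq β] {f : α → β} {u : β → ℝ}
    (hu : Summable u) (hu0 : ∀ b, 0 ≤ u b) (N : ℕ)
    (hN : ∀ b (s : Finset α), (∀ a ∈ s, f a = b) → s.card ≤ N) : Summable (u ∘ f) := by
  refine summable_of_sum_le (c := N * ∑' b, u b) (fun a ↦ hu0 _) fun s ↦ ?_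
  simp only [Function.comp_apply]
  rw [Finset.sum_comp]
  calc ∑ b ∈ s.image f, (s.filter fun a ↦ f a = b).card • u b
      ≤ ∑ b ∈ s.image f, (N : ℝ) * u b := by
        refine Finset.sum_le_sum fun b _ ↦ ?_
        rw [nsmul_eq_mul]
        refine mul_le_mul_of_nonneg_right ?_ (hu0 b)
        exact_mod_cast hN b _ fun a ha ↦ (Finset.mem_filter.mp ha).2
    _ ≤ N * ∑' b, u b := by
        rw [← Finset.mul_sum]
        exact mul_le_mul_of_nonneg_left (hu.sum_le_tsum _ fun b _ ↦ hu0 b) (Nat.cast_nonneg N)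

/-! ### The weight and its variation over hyperbolic distance. -/

/-- The function `Im(w)^κ |w - t|^{-r}` on the upper half-plane. -/
def weight (κ r t : ℝ) (w : ℍ) : ℝ := w.im ^ κ * ‖(w : ℂ) - t‖ ^ (-r)

theorem im_le_norm_sub_ofReal (w : ℍ) (t : ℝ) : w.im ≤ ‖(w : ℂ) - t‖ := by
  simpa [abs_of_pos w.im_pos] using Complex.abs_im_le_norm ((w : ℂ) - t)

theorem norm_sub_ofReal_pos (w : ℍ) (t : ℝ) : 0 < ‖(w : ℂ) - t‖ :=
  w.im_pos.trans_le (im_le_norm_sub_ofReal w t)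

theorem weight_pos (κ r t : ℝ) (w : ℍ) : 0 < weight κ r t w :=
  mul_pos (Real.rpow_pos_of_pos w.im_pos _) (Real.rpow_pos_of_pos (norm_sub_ofReal_pos w t) _)

/-- The Euclidean distance of `w` and `w'` is at most `Im w' (e^d - 1)`, with `d` their hyperbolic
distance, and `Im w' ≤ |w' - t|`. -/
theorem norm_sub_ofReal_le (w w' : ℍ) (t : ℝ) :
    ‖(w : ℂ) - t‖ ≤ ‖(w' : ℂ) - t‖ * Real.exp (dist w w') := by
  have h1 := dist_coe_le w w'
  have h2 : ‖(w : ℂ) - t‖ ≤ dist (w : ℂ) w' + ‖(w' : ℂ) - t‖ := by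
    rw [dist_eq_norm]
    simpa using norm_add_le ((w : ℂ) - w') (w' - t)
  have h3 := im_le_norm_sub_ofReal w' t
  have h4 : 0 ≤ Real.exp (dist w w') - 1 := by
    linarith [Real.add_one_le_exp (dist w w'), dist_nonneg (x := w) (y := w')]
  nlinarith [mul_le_mul_of_nonneg_right h3 h4]

/-- A Harnack inequality: it lets one base point serve for a whole compact set, and later `vert z`
replace `z`. -/
theorem weight_le_exp_mul {κ r : ℝ} (hκ : 0 ≤ κ) (hr : 0 ≤ r) (t : ℝ) {R : ℝ} {w w' : ℍ}
    (hd : dist w w' ≤ R) :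
    weight κ r t w ≤ Real.exp ((κ + r) * R) * weight κ r t w' := by
  have h1 : w.im ^ κ ≤ w'.im ^ κ * Real.exp (κ * R) := by
    rw [mul_comm κ R, Real.exp_mul, ← Real.mul_rpow w'.im_pos.le (Real.exp_pos _).le]
    refine Real.rpow_le_rpow w.im_pos.le ((im_le_im_mul_exp_dist w w').trans ?_) hκ
    exact mul_le_mul_of_nonneg_left (Real.exp_le_exp.mpr hd) w'.im_pos.le
  have h2 : ‖(w : ℂ) - t‖ ^ (-r) ≤ ‖(w' : ℂ) - t‖ ^ (-r) * Real.exp (r * R) := by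
    have h := norm_sub_ofReal_le w' w t
    rw [dist_comm] at h
    have h' : ‖(w' : ℂ) - t‖ ≤ ‖(w : ℂ) - t‖ * Real.exp R :=
      h.trans (mul_le_mul_of_nonneg_left (Real.exp_le_exp.mpr hd) (norm_nonneg _))
    have h3 := Real.rpow_le_rpow (norm_nonneg _) h' hr
    rw [Real.mul_rpow (norm_nonneg _) (Real.exp_pos _).le, ← Real.exp_mul, mul_comm R r] at h3
    rw [Real.rpow_neg (norm_nonneg _), Real.rpow_neg (norm_nonneg _), inv_mul_eq_div,
      inv_le_iff_one_le_mul₀ (Real.rpow_pos_of_pos (norm_sub_ofReal_pos w t) _), div_mul_eq_mul_div,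
      one_le_div (Real.rpow_pos_of_pos (norm_sub_ofReal_pos w' t) _)]
    linarith
  calc weight κ r t w
      ≤ (w'.im ^ κ * Real.exp (κ * R)) * (‖(w' : ℂ) - t‖ ^ (-r) * Real.exp (r * R)) :=
        mul_le_mul h1 h2 (Real.rpow_nonneg (norm_nonneg _) _)
          (mul_nonneg (Real.rpow_nonneg w'.im_pos.le _) (Real.exp_pos _).le)
    _ = Real.exp ((κ + r) * R) * weight κ r t w' := by
        rw [weight, add_mul, Real.exp_add]; ring

/-! ### Boxes and the convergence of orbit sums. -/

theorem summable_one_add_abs_int_rpow {r : ℝ} (hr : 1 < r) :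
    Summable fun n : ℤ ↦ (1 + |(n : ℝ)|) ^ (-r) := by
  -- The shift by `1/2` keeps every base `n + 1/2` nonzero.
  refine ((Real.summable_one_div_int_add_rpow (1 / 2) r).mpr hr).of_nonneg_of_le
    (fun n ↦ by positivity) fun n ↦ ?_
  have h0 : (0 : ℝ) < |(n : ℝ) + 1 / 2| := by
    rw [abs_pos]
    intro h
    have h2 : (2 * n + 1 : ℤ) = 0 := by
      have : (2 * n + 1 : ℝ) = 0 := by linarith
      exact_mod_cast this
    omega
  rw [Real.rpow_neg (by positivity), one_div]
  refine inv_anti₀ (Real.rpow_pos_of_pos h0 _) (Real.rpow_le_rpow h0.le ?_ (by linarith))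
  calc |(n : ℝ) + 1 / 2| ≤ |(n : ℝ)| + |1 / 2| := abs_add_le _ _
    _ ≤ 1 + |(n : ℝ)| := by rw [abs_of_pos (by norm_num : (0 : ℝ) < 1 / 2)]; linarith

/-- The layer of the strip `0 < Im w ≤ V` in which `w` lies: heights are cut at `V e^{-m}`. -/
def layer (V : ℝ) (w : ℍ) : ℕ := ⌊Real.log (V / w.im)⌋₊

/-- The top of the layer that contains `w`. -/
def layerHeight (V : ℝ) (w : ℍ) : ℝ := V * Real.exp (-(layer V w : ℝ))

/-- The box that contains `w`: its layer, and its place in the layer relative to `t`. -/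
def box (V t : ℝ) (w : ℍ) : ℕ × ℤ := (layer V w, ⌊(w.re - t) / layerHeight V w⌋)

theorem layerHeight_pos {V : ℝ} (hV : 0 < V) (w : ℍ) : 0 < layerHeight V w :=
  mul_pos hV (Real.exp_pos _)

theorem im_le_layerHeight {V : ℝ} {w : ℍ} (hw : w.im ≤ V) : w.im ≤ layerHeight V w := by
  have h1 : 1 ≤ V / w.im := (one_le_div w.im_pos).mpr hw
  have h2 := Nat.floor_le (Real.log_nonneg h1)
  have h3 := Real.exp_le_exp.mpr h2
  rw [Real.exp_log (by linarith), le_div_iff₀ w.im_pos] at h3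
  rw [layerHeight, Real.exp_neg, ← div_eq_mul_inv, le_div_iff₀ (Real.exp_pos _), mul_comm]
  exact h3

theorem layerHeight_le {V : ℝ} (hV : 0 < V) (w : ℍ) :
    layerHeight V w ≤ Real.exp 1 * w.im := by
  have h2 := (Nat.lt_floor_add_one (Real.log (V / w.im))).le
  have h3 := Real.exp_le_exp.mpr h2
  rw [Real.exp_log (div_pos hV w.im_pos), div_le_iff₀ w.im_pos, Real.exp_add] at h3
  rw [layerHeight, Real.exp_neg, ← div_eq_mul_inv, div_le_iff₀ (Real.exp_pos _)]
  calc V ≤ _ := h3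
    _ = _ := by rw [layer]; ring

/-- In the box `(m, n)`, with `ℓ = V e^{-m}`, one has `Im w ≤ ℓ` and `|w - t| ≥ ℓ(1+|n|)/8`. -/
theorem weight_le_of_im_le {κ r V : ℝ} (hκ : 0 ≤ κ) (hr : 0 ≤ r) (hV : 0 < V) (t : ℝ) {w : ℍ}
    (hw : w.im ≤ V) :
    weight κ r t w ≤ V ^ (κ - r) * 8 ^ r *
      (Real.exp (-(κ - r)) ^ (box V t w).1 * (1 + |((box V t w).2 : ℝ)|) ^ (-r)) := by
  set ℓ := layerHeight V w with hℓ
  have hℓ0 : 0 < ℓ := layerHeight_pos hV w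
  set n := (box V t w).2 with hn
  have hn' : n = ⌊(w.re - t) / ℓ⌋ := rfl
  have hm : (box V t w).1 = layer V w := rfl
  have h1 : w.im ^ κ ≤ ℓ ^ κ := Real.rpow_le_rpow w.im_pos.le (im_le_layerHeight hw) hκ
  have hfl : (n : ℝ) ≤ (w.re - t) / ℓ := by rw [hn']; exact Int.floor_le _
  have hfl2 : (w.re - t) / ℓ < n + 1 := by rw [hn']; exact Int.lt_floor_add_one _
  have hre : |w.re - t| ≤ ‖(w : ℂ) - t‖ := by simpa using Complex.abs_re_le_norm ((w : ℂ) - t)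
  have him := im_le_norm_sub_ofReal w t
  have hle := layerHeight_le hV w
  have h2 : ℓ * (1 + |(n : ℝ)|) / 8 ≤ ‖(w : ℂ) - t‖ := by
    rw [le_div_iff₀ hℓ0] at hfl
    rw [div_lt_iff₀ hℓ0] at hfl2
    have habs1 := le_abs_self (w.re - t)
    have habs2 := neg_abs_le (w.re - t)
    have he := Real.exp_one_lt_d9
    -- For `|n| ≤ 1` the height suffices, as `ℓ ≤ 3 Im w`. For `|n| ≥ 2` the real part does, being
    -- at least `(|n| - 1)ℓ` in absolute value.
    rcases lt_trichotomy (|n|) 2 with h | h | h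
    · have h3 : |(n : ℝ)| ≤ 1 := by
        have : |n| ≤ 1 := by omega
        exact_mod_cast this
      have : ℓ ≤ 3 * w.im := hle.trans (by nlinarith [w.im_pos])
      nlinarith
    all_goals
      have h4 : 2 ≤ |(n : ℝ)| := by
        have : 2 ≤ |n| := by omega
        exact_mod_cast this
      rcases abs_cases (n : ℝ) with ⟨h5, h6⟩ | ⟨h5, h6⟩ <;> rw [h5] at h4 ⊢ <;> nlinarith
  have h3 : ‖(w : ℂ) - t‖ ^ (-r) ≤ (ℓ * (1 + |(n : ℝ)|) / 8) ^ (-r) :=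
    Real.rpow_le_rpow_of_nonpos (by positivity) h2 (by linarith)
  have h4 : (ℓ * (1 + |(n : ℝ)|) / 8) ^ (-r) = ℓ ^ (-r) * (1 + |(n : ℝ)|) ^ (-r) * 8 ^ r := by
    rw [Real.div_rpow (by positivity) (by norm_num), Real.mul_rpow hℓ0.le (by positivity),
      Real.rpow_neg (by norm_num : (0 : ℝ) ≤ 8), div_inv_eq_mul]
  have h5 : ℓ ^ κ * ℓ ^ (-r) = V ^ (κ - r) * Real.exp (-(κ - r)) ^ layer V w := by
    rw [← Real.rpow_add hℓ0, ← sub_eq_add_neg, hℓ, layerHeight,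
      Real.mul_rpow hV.le (Real.exp_pos _).le, ← Real.exp_mul, ← Real.exp_nat_mul]
    ring_nf
  calc weight κ r t w ≤ ℓ ^ κ * (ℓ ^ (-r) * (1 + |(n : ℝ)|) ^ (-r) * 8 ^ r) := by
        rw [← h4]
        exact mul_le_mul h1 h3 (Real.rpow_nonneg (norm_nonneg _) _) (by positivity)
    _ = (ℓ ^ κ * ℓ ^ (-r)) * (1 + |(n : ℝ)|) ^ (-r) * 8 ^ r := by ring
    _ = _ := by rw [h5, hm]; ring

/-- The points are at Euclidean distance at most `2ℓ` and have heights at least `ℓ/3`; the quotient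
is 6. -/
theorem dist_le_of_box_eq {V t : ℝ} (hV : 0 < V) {w w' : ℍ} (hw : w.im ≤ V) (hw' : w'.im ≤ V)
    (h : box V t w = box V t w') : dist w w' ≤ 6 := by
  have hl : layer V w = layer V w' := congrArg Prod.fst h
  have hh : layerHeight V w' = layerHeight V w := by rw [layerHeight, layerHeight, hl]
  have hn : ⌊(w.re - t) / layerHeight V w⌋ = ⌊(w'.re - t) / layerHeight V w'⌋ :=
    congrArg Prod.snd h
  rw [hh] at hn
  have a1 := im_le_layerHeight hw
  have a2 := im_le_layerHeight hw'
  have b1 := layerHeight_le hV w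
  have b2 := layerHeight_le hV w'
  have hℓ0 := layerHeight_pos hV w
  rw [hh] at a2 b2
  set ℓ := layerHeight V w
  have hre : |w.re - w'.re| ≤ ℓ := by
    have h1 := Int.abs_sub_lt_one_of_floor_eq_floor hn
    rw [← sub_div, sub_sub_sub_cancel_right, abs_div, abs_of_pos hℓ0, div_lt_one hℓ0] at h1
    exact h1.le
  have him : |w.im - w'.im| ≤ ℓ := by
    rw [abs_le]; constructor <;> linarith [w.im_pos, w'.im_pos]
  have hd : dist (w : ℂ) w' ≤ 2 * ℓ := by
    rw [dist_eq_norm]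
    refine (Complex.norm_le_abs_re_add_abs_im _).trans ?_
    simp only [Complex.sub_re, Complex.sub_im, coe_re, coe_im]
    linarith
  have he : Real.exp 1 ≤ 3 := by linarith [Real.exp_one_lt_d9]
  have hs : ℓ / 3 ≤ √(w.im * w'.im) := by
    refine Real.le_sqrt_of_sq_le ?_
    have c1 : ℓ / 3 ≤ w.im := by nlinarith [w.im_pos]
    have c2 : ℓ / 3 ≤ w'.im := by nlinarith [w'.im_pos]
    rw [sq]
    exact mul_le_mul c1 c2 (by positivity) w.im_pos.le
  refine (dist_le_dist_coe_div_sqrt w w').trans ?_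
  rw [div_le_iff₀ (by positivity)]
  linarith

/-- The orbit sums of `weight` converge if the heights of the orbit are bounded. -/
theorem summable_weight_orbit (G : Subgroup SL(2, ℝ)) [DiscreteTopology G] (h : SL(2, ℝ)) (z : ℍ)
    {V : ℝ} (hV : 0 < V) (hG : ∀ g ∈ G, (h • g • z).im ≤ V) {κ r : ℝ} (hr : 1 < r) (hκ : r < κ)
    (t : ℝ) : Summable fun g : G ↦ weight κ r t (h • (g : SL(2, ℝ)) • z) := by
  classical
  set u : ℕ × ℤ → ℝ := fun b ↦ V ^ (κ - r) * 8 ^ r *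
    (Real.exp (-(κ - r)) ^ b.1 * (1 + |(b.2 : ℝ)|) ^ (-r)) with hu
  have hus : Summable u := by
    refine Summable.mul_left _ ?_
    refine Summable.mul_of_nonneg (f := fun m : ℕ ↦ Real.exp (-(κ - r)) ^ m)
      (g := fun n : ℤ ↦ (1 + |(n : ℝ)|) ^ (-r)) ?_ (summable_one_add_abs_int_rpow hr)
      (fun m ↦ by positivity) (fun n ↦ by positivity)
    exact summable_geometric_of_lt_one (Real.exp_pos _).le (by rw [Real.exp_lt_one_iff]; linarith)
  refine Summable.of_nonneg_of_le (fun g ↦ (weight_pos _ _ _ _).le)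
    (fun g ↦ weight_le_of_im_le (by linarith) (by linarith) hV t (hG g g.2))
    (summable_comp_of_fiber_card_le (u := u)
      (f := fun g : G ↦ box V t (h • (g : SL(2, ℝ)) • z)) hus (fun b ↦ by positivity)
      (finite_dist_smul_le G z 6).toFinset.card fun b s hs ↦ ?_)
  rcases s.eq_empty_or_nonempty with rfl | ⟨g₀, hg₀⟩
  · simp
  -- If `g` and `g₀` land in the same box, `g₀⁻¹g` moves `z` by at most 6; the number of such
  -- elements does not depend on the box.
  refine Finset.card_le_card_of_injOn (fun g ↦ g₀⁻¹ * g) (fun g hg ↦ ?_)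
    (fun g _ g' _ hgg ↦ mul_left_cancel hgg)
  simp only [Set.Finite.coe_toFinset, Set.mem_ofPred_eq]
  have hd := dist_le_of_box_eq hV (hG g g.2) (hG g₀ g₀.2) ((hs g hg).trans (hs g₀ hg₀).symm)
  rw [dist_smul] at hd
  have e : (g₀⁻¹ * g) • z = (g₀ : SL(2, ℝ))⁻¹ • (g : SL(2, ℝ)) • z := by
    rw [mul_smul]; rfl
  rw [e, ← dist_smul (g₀ : SL(2, ℝ)), smul_inv_smul]
  exact hd

/-- A wider range of exponents is allowed if the orbit also stays outside a horoball at `t`. -/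
theorem summable_weight_orbit_of_horoball (G : Subgroup SL(2, ℝ)) [DiscreteTopology G]
    (h : SL(2, ℝ)) (z : ℍ) {V : ℝ} (hV : 0 < V) (hG : ∀ g ∈ G, (h • g • z).im ≤ V) (t : ℝ)
    {C : ℝ} (hC : 0 < C)
    (hG' : ∀ g ∈ G, (h • g • z).im ≤ C * ‖((h • g • z : ℍ) : ℂ) - t‖ ^ 2)
    {κ r : ℝ} (hr : 1 < r) (hκ : r < 2 * κ - 1) :
    Summable fun g : G ↦ weight κ r t (h • (g : SL(2, ℝ)) • z) := by
  -- With `e = (r - r')/2`, the horoball bound gives `|w - t|^{-2e} ≤ (C / Im w)^e`, leaving the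
  -- exponents `κ - e` and `r'`. They are admissible because `r' < κ - e` is equivalent to `r' < 2κ
  -- - r`.
  obtain ⟨r', h1, h2⟩ := exists_between (lt_min hr (by linarith : 1 < 2 * κ - r))
  obtain ⟨h2, h3⟩ := lt_min_iff.mp h2
  set e := (r - r') / 2 with he
  have hs := summable_weight_orbit G h z hV hG h1 (κ := κ - e) (by rw [he]; linarith) t
  refine Summable.of_nonneg_of_le (fun g ↦ (weight_pos _ _ _ _).le) (fun g ↦ ?_)
    (hs.mul_left (C ^ e))
  have hb := hG' g g.2
  set w := h • (g : SL(2, ℝ)) • z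
  have hw := norm_sub_ofReal_pos w t
  have he0 : 0 ≤ e := by rw [he]; linarith
  have k1 : ‖(w : ℂ) - t‖ ^ (-r) = ‖(w : ℂ) - t‖ ^ (-r') * (‖(w : ℂ) - t‖ ^ 2) ^ (-e) := by
    rw [← Real.rpow_natCast, ← Real.rpow_mul hw.le, ← Real.rpow_add hw]
    congr 1
    rw [he]; push_cast; ring
  have k2 : (‖(w : ℂ) - t‖ ^ 2) ^ (-e) ≤ (w.im / C) ^ (-e) := by
    refine Real.rpow_le_rpow_of_nonpos (div_pos w.im_pos hC) ?_ (by linarith)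
    rw [div_le_iff₀ hC]; linarith
  have k3 : (w.im / C) ^ (-e) = w.im ^ (-e) * C ^ e := by
    rw [Real.div_rpow w.im_pos.le hC.le, Real.rpow_neg hC.le, div_inv_eq_mul]
  calc weight κ r t w
      ≤ w.im ^ κ * (‖(w : ℂ) - t‖ ^ (-r') * (w.im ^ (-e) * C ^ e)) := by
        rw [weight, k1, ← k3]
        have := w.im_pos
        gcongr
    _ = C ^ e * weight (κ - e) r' t w := by
        rw [weight, sub_eq_add_neg κ, Real.rpow_add w.im_pos]; ring

/-! ### Matrices and the coordinate at a cusp. -/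

theorem coe_GL_smul (g : SL(2, ℝ)) (z : ℍ) : (g : GL (Fin 2) ℝ) • z = g • z :=
  rfl

/-- The matrix `(t -1; 1 0)`, which maps `∞` to `t`. -/
def toReal (t : ℝ) : SL(2, ℝ) := ⟨!![t, -1; 1, 0], by simp⟩

theorem toReal_smul_infty (t : ℝ) :
    (toReal t : GL (Fin 2) ℝ) • (OnePoint.infty : OnePoint ℝ) = (t : OnePoint ℝ) := by
  have h0 : (toReal t : GL (Fin 2) ℝ) 0 0 = t := rfl
  have h1 : (toReal t : GL (Fin 2) ℝ) 1 0 = 1 := rfl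
  rw [OnePoint.smul_infty_eq_ite, h0, h1]
  simp

theorem exists_SL_smul_infty_eq (c : OnePoint ℝ) :
    ∃ ρ : SL(2, ℝ), (ρ : GL (Fin 2) ℝ) • (OnePoint.infty : OnePoint ℝ) = c := by
  cases c with
  | infty => exact ⟨1, by simp⟩
  | coe t => exact ⟨toReal t, toReal_smul_infty t⟩

theorem det_coe_SL (h : SL(2, ℝ)) : ((h : GL (Fin 2) ℝ).det : ℝ) = 1 := by simp

theorem im_SL_smul (h : SL(2, ℝ)) (z : ℍ) :
    (h • z).im = z.im / ‖denom (h : GL (Fin 2) ℝ) z‖ ^ 2 := by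
  rw [← coe_GL_smul, im_smul_eq_div_normSq, det_coe_SL, abs_one, one_mul, Complex.normSq_eq_norm_sq]

theorem coe_SL_smul (h : SL(2, ℝ)) (z : ℍ) :
    ((h • z : ℍ) : ℂ) = num (h : GL (Fin 2) ℝ) z / denom (h : GL (Fin 2) ℝ) z := by
  rw [← coe_GL_smul, coe_smul_of_det_pos (by rw [det_coe_SL]; exact one_pos)]

/-- Shows that bounded height in the coordinate of `t` means avoiding a horoball at `t`. -/
theorem im_toReal_inv_smul (t : ℝ) (w : ℍ) :
    ((toReal t)⁻¹ • w).im = w.im / ‖(w : ℂ) - t‖ ^ 2 := by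
  rw [im_SL_smul]
  have h0 : ((toReal t)⁻¹ : GL (Fin 2) ℝ) 1 0 = -1 := by
    rw [← map_inv, Matrix.SpecialLinearGroup.SL2_inv_expl]; rfl
  have h1 : ((toReal t)⁻¹ : GL (Fin 2) ℝ) 1 1 = t := by
    rw [← map_inv, Matrix.SpecialLinearGroup.SL2_inv_expl]; rfl
  rw [map_inv, denom, h0, h1, ← norm_neg]
  congr 3
  push_cast
  ring

theorem neg_mem_liftSL {Γ : Subgroup PSL(2, ℝ)} {g : SL(2, ℝ)} (hg : g ∈ liftSL Γ) :
    -g ∈ liftSL Γ := by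
  have h1 : (-1 : SL(2, ℝ)) ∈ liftSL Γ := by
    have h2 : (-1 : SL(2, ℝ)) ∈ Subgroup.center SL(2, ℝ) := by
      rw [Subgroup.mem_center_iff]; intro g; simp
    have h3 : QuotientGroup.mk' (Subgroup.center SL(2, ℝ)) (-1) = 1 :=
      (QuotientGroup.eq_one_iff _).mpr h2
    rw [liftSL, Subgroup.mem_comap, h3]
    exact one_mem Γ
  simpa using mul_mem h1 hg

theorem coe_neg_SL (g : SL(2, ℝ)) : ((-g : SL(2, ℝ)) : GL (Fin 2) ℝ) = -(g : GL (Fin 2) ℝ) := by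
  ext i j; simp

open Matrix.GeneralLinearGroup in
/-- In the coordinate of a cusp, one of the elements that fix it is a translation. -/
theorem IsCuspOf.exists_translation {Γ : Subgroup PSL(2, ℝ)} {c : OnePoint ℝ} (hc : IsCuspOf Γ c)
    {ρ : SL(2, ℝ)} (hρ : (ρ : GL (Fin 2) ℝ) • (OnePoint.infty : OnePoint ℝ) = c) :
    ∃ p ∈ liftSL Γ, ∃ x : ℝ, x ≠ 0 ∧
      (p : GL (Fin 2) ℝ) * (ρ : GL (Fin 2) ℝ) = ρ * upperRightHom x := by
  obtain ⟨_, ⟨p, hp, rfl⟩, hpar, hfix⟩ := hc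
  set q : GL (Fin 2) ℝ := (ρ : GL (Fin 2) ℝ)⁻¹ * p * ρ with hq
  have hq10 : q 1 0 = 0 := by
    rw [← OnePoint.smul_infty_eq_self_iff, hq, mul_smul, mul_smul, hρ, hfix, inv_smul_eq_iff, hρ]
  have hdet : q.det = 1 := by rw [hq]; simp
  have hqpar : q.IsParabolic := by rw [hq, isParabolic_conj_iff']; exact hpar
  have hpq : (p : GL (Fin 2) ℝ) * ρ = ρ * q := by rw [hq]; group
  -- An upper triangular parabolic matrix of determinant 1 is plus or minus a translation; the sign
  -- is absorbed since `liftSL Γ` contains `-1`.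
  rcases (isParabolic_iff_of_upperTriangular_of_det (Or.inl hdet) hq10).mp hqpar with
    ⟨x, hx, h⟩ | ⟨x, hx, h⟩
  · exact ⟨p, hp, x, hx, by rw [hpq, h]⟩
  · exact ⟨-p, neg_mem_liftSL hp, x, hx, by rw [coe_neg_SL, neg_mul, hpq, h, mul_neg, neg_neg]⟩

theorem upperRightHom_smul (x : ℝ) (z : ℍ) :
    Matrix.GeneralLinearGroup.upperRightHom x • z = x +ᵥ z := by
  ext
  simp [UpperHalfPlane.σ, num, denom, coe_vadd, UpperHalfPlane.coe_smul, add_comm]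

theorem IsCuspOf.exists_im_orbit_le {Γ : Subgroup PSL(2, ℝ)} [DiscreteTopology (liftSL Γ)]
    {c : OnePoint ℝ} (hc : IsCuspOf Γ c) {ρ : SL(2, ℝ)}
    (hρ : (ρ : GL (Fin 2) ℝ) • (OnePoint.infty : OnePoint ℝ) = c) (z : ℍ) :
    ∃ V > 0, ∀ g ∈ liftSL Γ, (ρ⁻¹ • g • z).im ≤ V := by
  obtain ⟨p, hp, x, hx, h⟩ := hc.exists_translation hρ
  refine CuspKernel.exists_im_orbit_le _ ρ hx hp (fun w ↦ ?_) z
  rw [← coe_GL_smul p, ← coe_GL_smul ρ, ← coe_GL_smul ρ, smul_smul, h, mul_smul,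
    upperRightHom_smul]

/-! ### Majorization and uniform convergence of the series. -/

theorem norm_denom_zpow (h : SL(2, ℝ)) (k : ℤ) (z : ℍ) :
    ‖denom (h : GL (Fin 2) ℝ) z‖ ^ (-k) = z.im ^ (-(k / 2 : ℝ)) * (h • z).im ^ (k / 2 : ℝ) := by
  have hd : 0 < ‖denom (h : GL (Fin 2) ℝ) z‖ := norm_pos_iff.mpr (denom_ne_zero _ z)
  rw [im_SL_smul, Real.div_rpow z.im_pos.le (by positivity), Real.rpow_neg z.im_pos.le,
    ← Real.rpow_natCast, ← Real.rpow_mul hd.le, zpow_neg, ← Real.rpow_intCast]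
  have := Real.rpow_pos_of_pos z.im_pos (k / 2 : ℝ)
  have e : ((2 : ℕ) : ℝ) * (k / 2 : ℝ) = k := by push_cast; ring
  rw [e]
  field_simp

theorem sub_conj_ne_zero {τ : ℂ} (hτ : 0 ≤ τ.im) (w : ℍ) : (w : ℂ) - conj τ ≠ 0 := by
  intro h
  have := congrArg Complex.im h
  simp at this
  linarith [w.im_pos]

/-- The exponential factor accounts for the argument of the base of the complex power, which is at
most `π` in absolute value. -/
theorem norm_matrixTerm_le (h : SL(2, ℝ)) (k : ℤ) {τ : ℂ} (hτ : 0 ≤ τ.im) (z : ℍ) (s : ℂ) :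
    ‖matrixTerm h k τ z s‖ ≤ Real.exp (Real.pi * |s.im|) * z.im ^ (-(k / 2 : ℝ)) *
      ((h • z).im ^ (k / 2 : ℝ) * ‖((h • z : ℍ) : ℂ) - conj τ‖ ^ (-s.re)) := by
  have hw := sub_conj_ne_zero hτ (h • z)
  have harg : (((h • z : ℍ) : ℂ) - conj τ).arg * s.im ≤ Real.pi * |s.im| := by
    refine (le_abs_self _).trans ?_
    rw [abs_mul]
    exact mul_le_mul_of_nonneg_right (Complex.abs_arg_le_pi _) (abs_nonneg _)
  rw [matrixTerm, norm_div, norm_one, norm_mul, norm_zpow, Complex.norm_cpow_of_ne_zero hw,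
    one_div, mul_inv, inv_div, ← zpow_neg, norm_denom_zpow, div_eq_mul_inv,
    ← Real.rpow_neg (norm_nonneg _)]
  have h1 := Real.exp_le_exp.mpr harg
  have h2 := (h • z).im_pos
  have h3 := z.im_pos
  calc _ ≤ Real.exp (Real.pi * |s.im|) * ‖((h • z : ℍ) : ℂ) - conj τ‖ ^ (-s.re) *
      (z.im ^ (-(k / 2 : ℝ)) * (h • z).im ^ (k / 2 : ℝ)) := by gcongr
    _ = _ := by ring

theorem denom_mul_SL (h ρ : SL(2, ℝ)) (z : ℍ) :
    denom ((h * ρ : SL(2, ℝ)) : GL (Fin 2) ℝ) z =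
      denom (h : GL (Fin 2) ℝ) ((ρ • z : ℍ) : ℂ) * denom (ρ : GL (Fin 2) ℝ) z := by
  rw [map_mul, denom_cocycle _ _ z.im_ne_zero, ← coe_SL_smul]

theorem matrixTerm_mul (h ρ : SL(2, ℝ)) (k : ℤ) (τ : ℂ) (z : ℍ) (s : ℂ) :
    matrixTerm (h * ρ) k τ z s =
      matrixTerm h k τ (ρ • z) s * denom (ρ : GL (Fin 2) ℝ) z ^ (-k) := by
  rw [matrixTerm, matrixTerm, denom_mul_SL, mul_smul, mul_zpow, zpow_neg, ← mul_assoc, one_div,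
    mul_inv, one_div]

theorem slash_SL_apply (f : ℍ → ℂ) (k : ℤ) (g : SL(2, ℝ)) (z : ℍ) :
    (f ∣[k] (g : GL (Fin 2) ℝ)) z = f (g • z) * denom (g : GL (Fin 2) ℝ) z ^ (-k) := by
  simp [ModularForm.slash_apply, UpperHalfPlane.σ, coe_GL_smul]

/-- The orbit sum of `|w - τ̄|^{-r} Im(w)^{k/2}` is dominated by a convergent sum of weights. -/
def IsMajorized (Γ : Subgroup PSL(2, ℝ)) (σ : SL(2, ℝ)) (k : ℤ) (τ : ℂ) (r : ℝ) : Prop :=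
  ∃ r' C : ℝ, 0 < r' ∧ r' < k ∧ 0 ≤ C ∧
    (∀ w : ℍ, ‖(w : ℂ) - conj τ‖ ^ (-r) ≤ C * ‖(w : ℂ) - τ.re‖ ^ (-r')) ∧
    ∀ z : ℍ, Summable fun g : liftSL Γ ↦ weight (k / 2) r' τ.re (σ⁻¹ • (g : SL(2, ℝ)) • z)

theorem mk_out (γ : PSL(2, ℝ)) : ((Quotient.out γ : SL(2, ℝ)) : PSL(2, ℝ)) = γ :=
  Quotient.out_eq _

theorem out_mem_liftSL {Γ : Subgroup PSL(2, ℝ)} (γ : Γ) :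
    Quotient.out (γ : PSL(2, ℝ)) ∈ liftSL Γ := by
  rw [liftSL, Subgroup.mem_comap, QuotientGroup.mk'_apply, mk_out]
  exact γ.2

/-- The representative of `γ` that `omegaTerm` uses, as an element of the full preimage of `Γ`. -/
def outLift {Γ : Subgroup PSL(2, ℝ)} (γ : Γ) : liftSL Γ :=
  ⟨Quotient.out (γ : PSL(2, ℝ)), out_mem_liftSL γ⟩

theorem mk_outLift {Γ : Subgroup PSL(2, ℝ)} (γ : Γ) :
    ((outLift γ : SL(2, ℝ)) : PSL(2, ℝ)) = γ :=
  mk_out _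

/-- Makes the sum over `Γ` a subsum of one over `liftSL Γ`, where the orbit sums live. -/
theorem outLift_injective (Γ : Subgroup PSL(2, ℝ)) :
    Function.Injective (outLift : Γ → liftSL Γ) := fun γ γ' h ↦
  Subtype.ext (by rw [← mk_outLift γ, h, mk_outLift])

theorem omegaTerm_eq {Γ : Subgroup PSL(2, ℝ)} (σ : SL(2, ℝ)) (k : ℤ) (τ : ℂ) (γ : Γ) (z : ℍ)
    (s : ℂ) : omegaTerm σ k τ γ z s = matrixTerm (σ⁻¹ * outLift γ) k τ z s := rfl

/-- The majorant for the Weierstrass test. Compactness supplies the extreme values of `Re s`, `|Im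
s|` and the distance of `z` from `I`; the weights are then moved to the orbit of `I`. -/
theorem exists_summable_bound {Γ : Subgroup PSL(2, ℝ)} {σ : SL(2, ℝ)} {k : ℤ} (hk : 0 < k) {τ : ℂ}
    (hτ : 0 ≤ τ.im) {K : Set (ℍ × ℂ)} (hK : IsCompact K)
    (hmaj : ∀ p ∈ K, IsMajorized Γ σ k τ p.2.re) :
    ∃ u : Γ → ℝ, Summable u ∧ ∀ γ : Γ, ∀ p ∈ K, ‖omegaTerm σ k τ γ p.1 p.2‖ ≤ u γ := by
  rcases K.eq_empty_or_nonempty with rfl | hne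
  · exact ⟨0, summable_zero, by simp⟩
  have hκ : (0 : ℝ) < (k / 2 : ℝ) := by positivity
  obtain ⟨p₁, hp₁, hmin⟩ := hK.exists_isMinOn hne
    (f := fun p ↦ p.2.re) (Complex.continuous_re.comp continuous_snd).continuousOn
  obtain ⟨p₂, hp₂, hmax⟩ := hK.exists_isMaxOn hne
    (f := fun p ↦ p.2.re) (Complex.continuous_re.comp continuous_snd).continuousOn
  obtain ⟨p₃, hp₃, hB⟩ := hK.exists_isMaxOn hne
    (f := fun p ↦ |p.2.im|) (Complex.continuous_im.comp continuous_snd).abs.continuousOn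
  obtain ⟨p₄, hp₄, hR⟩ := hK.exists_isMaxOn hne
    (f := fun p ↦ dist p.1 I) (continuous_fst.dist continuous_const).continuousOn
  set B := |p₃.2.im|
  set R := dist p₄.1 I
  obtain ⟨r₁, C₁, hr₁, -, hC₁, hle₁, hs₁⟩ := hmaj p₁ hp₁
  obtain ⟨r₂, C₂, hr₂, -, hC₂, hle₂, hs₂⟩ := hmaj p₂ hp₂
  refine ⟨fun γ ↦ Real.exp (Real.pi * B) * Real.exp (-R) ^ (-(k / 2 : ℝ)) *
    (C₁ * (Real.exp ((k / 2 + r₁) * R) *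
        weight (k / 2) r₁ τ.re (σ⁻¹ • (outLift γ : SL(2, ℝ)) • I)) +
      C₂ * (Real.exp ((k / 2 + r₂) * R) *
        weight (k / 2) r₂ τ.re (σ⁻¹ • (outLift γ : SL(2, ℝ)) • I))),
    (((((hs₁ I).comp_injective (outLift_injective Γ)).mul_left _).mul_left _).add
      ((((hs₂ I).comp_injective (outLift_injective Γ)).mul_left _).mul_left _)).mul_left _, ?_⟩
  rintro γ ⟨z, s⟩ hp
  have hsB : |s.im| ≤ B := hB hp
  have hzR : dist z I ≤ R := hR hp
  have hs1 : p₁.2.re ≤ s.re := hmin hp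
  have hs2 : s.re ≤ p₂.2.re := hmax hp
  set h := σ⁻¹ * (outLift γ : SL(2, ℝ)) with hh
  have hI : h • I = σ⁻¹ • (outLift γ : SL(2, ℝ)) • I := by rw [hh, mul_smul]
  beta_reduce
  rw [← hI]
  have hd : dist (h • z) (h • I) ≤ R := by rwa [dist_smul]
  have hw₁ := weight_le_exp_mul hκ.le hr₁.le τ.re hd
  have hw₂ := weight_le_exp_mul hκ.le hr₂.le τ.re hd
  have him : z.im ^ (-(k / 2 : ℝ)) ≤ Real.exp (-R) ^ (-(k / 2 : ℝ)) := by
    refine Real.rpow_le_rpow_of_nonpos (Real.exp_pos _) ?_ (by linarith)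
    have h1 := im_le_im_mul_exp_dist I z
    rw [dist_comm, I_im] at h1
    rw [Real.exp_neg, inv_le_iff_one_le_mul₀ (Real.exp_pos _)]
    exact h1.trans (mul_le_mul_of_nonneg_left (Real.exp_le_exp.mpr hzR) z.im_pos.le)
  have hw0 := (h • z).im_pos
  set x := ‖((h • z : ℍ) : ℂ) - conj τ‖ with hx
  have hx0 : 0 < x := norm_pos_iff.mpr (sub_conj_ne_zero hτ _)
  -- A power of `x` is monotone in its exponent, so an intermediate one is bounded by the sum of the
  -- two extreme ones.
  have hpow : x ^ (-s.re) ≤ x ^ (-p₁.2.re) + x ^ (-p₂.2.re) := by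
    rcases le_or_gt 1 x with h1 | h1
    · have := Real.rpow_le_rpow_of_exponent_le h1 (neg_le_neg hs1)
      linarith [Real.rpow_pos_of_pos hx0 (-p₂.2.re)]
    · have := Real.rpow_le_rpow_of_exponent_ge hx0 h1.le (neg_le_neg hs2)
      linarith [Real.rpow_pos_of_pos hx0 (-p₁.2.re)]
  have hsum : (h • z).im ^ (k / 2 : ℝ) * x ^ (-s.re) ≤
      C₁ * weight (k / 2) r₁ τ.re (h • z) + C₂ * weight (k / 2) r₂ τ.re (h • z) := by
    calc (h • z).im ^ (k / 2 : ℝ) * x ^ (-s.re)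
        ≤ (h • z).im ^ (k / 2 : ℝ) * (C₁ * ‖((h • z : ℍ) : ℂ) - τ.re‖ ^ (-r₁) +
            C₂ * ‖((h • z : ℍ) : ℂ) - τ.re‖ ^ (-r₂)) := by
          refine mul_le_mul_of_nonneg_left (hpow.trans (add_le_add (hle₁ _) (hle₂ _))) ?_
          positivity
      _ = _ := by rw [weight, weight]; ring
  have hz := z.im_pos
  calc ‖omegaTerm σ k τ γ z s‖
      ≤ Real.exp (Real.pi * |s.im|) * z.im ^ (-(k / 2 : ℝ)) *
          ((h • z).im ^ (k / 2 : ℝ) * x ^ (-s.re)) := norm_matrixTerm_le h k hτ z s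
    _ ≤ _ := by
        gcongr
        exact hsum.trans (add_le_add (mul_le_mul_of_nonneg_left hw₁ hC₁)
          (mul_le_mul_of_nonneg_left hw₂ hC₂))

theorem summable_norm_omegaTerm {Γ : Subgroup PSL(2, ℝ)} {σ : SL(2, ℝ)} {k : ℤ}
    (hk : 0 < k) {τ : ℂ} (hτ : 0 ≤ τ.im) {D : Set ℂ}
    (hmaj : ∀ s ∈ D, IsMajorized Γ σ k τ s.re) :
    ∀ z : ℍ, ∀ s ∈ D, Summable fun γ : Γ ↦ ‖omegaTerm σ k τ γ z s‖ := by
    intro z s hs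
    obtain ⟨u, hu, hle⟩ := exists_summable_bound hk hτ (isCompact_singleton (x := (z, s)))
      (fun p hp ↦ by rw [Set.mem_singleton_iff.mp hp]; exact hmaj s hs)
    exact hu.of_nonneg_of_le (fun γ ↦ norm_nonneg _) fun γ ↦ hle γ (z, s) (Set.mem_singleton _)

theorem hasSumUniformlyOn_omegaTerm {Γ : Subgroup PSL(2, ℝ)} {σ : SL(2, ℝ)} {k : ℤ}
    (hk : 0 < k) {τ : ℂ} (hτ : 0 ≤ τ.im) {D : Set ℂ}
    (hmaj : ∀ s ∈ D, IsMajorized Γ σ k τ s.re) (K : Set (ℍ × ℂ)) (hK : IsCompact K)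
    (hKD : K ⊆ Set.univ ×ˢ D):
      HasSumUniformlyOn (fun (γ : Γ) (p : ℍ × ℂ) ↦ omegaTerm σ k τ γ p.1 p.2)
      (fun p ↦ Omega Γ σ k τ p.1 p.2) K := by
    obtain ⟨u, hu, hle⟩ := exists_summable_bound hk hτ hK fun p hp ↦ hmaj _ (hKD hp).2
    exact HasSumUniformlyOn.of_norm_le_summable
      (f := fun (γ : Γ) (p : ℍ × ℂ) ↦ omegaTerm σ k τ γ p.1 p.2) hu hle

theorem hasSumUniformlyOn_norm_omegaTerm {Γ : Subgroup PSL(2, ℝ)} {σ : SL(2, ℝ)} {k : ℤ}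
    (hk : 0 < k) {τ : ℂ} (hτ : 0 ≤ τ.im) {D : Set ℂ}
    (hmaj : ∀ s ∈ D, IsMajorized Γ σ k τ s.re) (K : Set (ℍ × ℂ)) (hK : IsCompact K)
    (hKD : K ⊆ Set.univ ×ˢ D):
    HasSumUniformlyOn (fun (γ : Γ) (p : ℍ × ℂ) ↦ ‖omegaTerm σ k τ γ p.1 p.2‖)
      (fun p ↦ ∑' γ : Γ, ‖omegaTerm σ k τ γ p.1 p.2‖) K := by
    obtain ⟨u, hu, hle⟩ := exists_summable_bound hk hτ hK fun p hp ↦ hmaj _ (hKD hp).2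
    refine HasSumUniformlyOn.of_norm_le_summable
      (f := fun (γ : Γ) (p : ℍ × ℂ) ↦ ‖omegaTerm σ k τ γ p.1 p.2‖) hu fun γ p hp ↦ ?_
    rw [norm_norm]; exact hle γ p hp

theorem convergesAbsolutelyUniformly_of_isMajorized {Γ : Subgroup PSL(2, ℝ)} {σ : SL(2, ℝ)} {k : ℤ}
    (hk : 0 < k) {τ : ℂ} (hτ : 0 ≤ τ.im) {D : Set ℂ}
    (hmaj : ∀ s ∈ D, IsMajorized Γ σ k τ s.re) : ConvergesAbsolutelyUniformly Γ σ k τ D :=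
  ⟨summable_norm_omegaTerm hk hτ hmaj, hasSumUniformlyOn_omegaTerm hk hτ hmaj,
    hasSumUniformlyOn_norm_omegaTerm hk hτ hmaj⟩

/-! ### Modularity and holomorphy. -/

theorem Omega_slash_apply (Γ : Subgroup PSL(2, ℝ)) (σ : SL(2, ℝ)) (k : ℤ) (τ : ℂ) (s : ℂ)
    (ρ : SL(2, ℝ)) (z : ℍ) :
    ((fun w ↦ Omega Γ σ k τ w s) ∣[k] (ρ : GL (Fin 2) ℝ)) z =
      ∑' γ : Γ, matrixTerm (σ⁻¹ * outLift γ * ρ) k τ z s := by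
  rw [slash_SL_apply, Omega, ← tsum_mul_right]
  exact tsum_congr fun γ ↦ by rw [omegaTerm_eq, ← matrixTerm_mul]

theorem Omega_slash_of_mem {Γ : Subgroup PSL(2, ℝ)} {σ : SL(2, ℝ)} {k : ℤ} (hk : Even k) (τ : ℂ)
    (s : ℂ) {g : SL(2, ℝ)} (hg : g ∈ liftSL Γ) :
    (fun w ↦ Omega Γ σ k τ w s) ∣[k] (g : GL (Fin 2) ℝ) = fun w ↦ Omega Γ σ k τ w s := by
  ext z
  have hg' : (g : PSL(2, ℝ)) ∈ Γ := hg
  rw [Omega_slash_apply, Omega, ← (Equiv.mulRight (⟨(g : PSL(2, ℝ)), hg'⟩ : Γ)).tsum_eq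
    fun γ : Γ ↦ omegaTerm σ k τ γ z s]
  refine tsum_congr fun γ ↦ ?_
  have h : ((outLift γ * g : SL(2, ℝ)) : PSL(2, ℝ)) = γ * (g : PSL(2, ℝ)) := by
    rw [QuotientGroup.mk_mul, mk_outLift]
  rw [mul_assoc, ← omegaTerm_mk σ hk, h]
  rfl

theorem differentiableOn_matrixTerm (h : SL(2, ℝ)) (k : ℤ) {τ : ℂ} (hτ : 0 ≤ τ.im) (s : ℂ) :
    DifferentiableOn ℂ (fun w ↦ matrixTerm h k τ (ofComplex w) s) {w : ℂ | 0 < w.im} := by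
  have hcongr : ∀ w ∈ {w : ℂ | 0 < w.im}, matrixTerm h k τ (ofComplex w) s =
      1 / ((num (h : GL (Fin 2) ℝ) w / denom (h : GL (Fin 2) ℝ) w - conj τ) ^ s *
        denom (h : GL (Fin 2) ℝ) w ^ k) := by
    intro w hw
    rw [matrixTerm, coe_SL_smul, ofComplex_apply_of_im_pos hw]
  refine DifferentiableOn.congr (fun w hw ↦ ?_) hcongr
  have hw' : 0 < w.im := hw
  have hd : denom (h : GL (Fin 2) ℝ) w ≠ 0 := denom_ne_zero_of_im _ hw'.ne'
  have hdd : DifferentiableAt ℂ (fun w ↦ denom (h : GL (Fin 2) ℝ) w) w := by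
    unfold denom; fun_prop
  have hnd : DifferentiableAt ℂ (fun w ↦ num (h : GL (Fin 2) ℝ) w) w := by
    unfold num; fun_prop
  have hbase : 0 < (num (h : GL (Fin 2) ℝ) w / denom (h : GL (Fin 2) ℝ) w - conj τ).im := by
    have h1 := (h • (⟨w, hw'⟩ : ℍ)).im_pos
    rw [← coe_im, coe_SL_smul] at h1
    simp only [Complex.sub_im, Complex.conj_im]
    have h2 : (num (h : GL (Fin 2) ℝ) w / denom (h : GL (Fin 2) ℝ) w).im > 0 := h1
    linarith
  have hslit : num (h : GL (Fin 2) ℝ) w / denom (h : GL (Fin 2) ℝ) w - conj τ ∈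
      Complex.slitPlane := Or.inr hbase.ne'
  have h0 : num (h : GL (Fin 2) ℝ) w / denom (h : GL (Fin 2) ℝ) w - conj τ ≠ 0 :=
    Complex.slitPlane_ne_zero hslit
  refine DifferentiableAt.differentiableWithinAt ?_
  refine (differentiableAt_const _).div (DifferentiableAt.mul ?_ ?_) ?_
  · exact ((hnd.div hdd hd).sub_const _).cpow (differentiableAt_const _) hslit
  · exact hdd.zpow (Or.inl hd)
  · exact mul_ne_zero (by simp [Complex.cpow_eq_zero_iff, h0]) (zpow_ne_zero _ hd)

theorem differentiableOn_Omega {Γ : Subgroup PSL(2, ℝ)} {σ : SL(2, ℝ)} {k : ℤ} (hk : 0 < k) {τ : ℂ}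
    (hτ : 0 ≤ τ.im) {s : ℂ} (hmaj : IsMajorized Γ σ k τ s.re) :
    DifferentiableOn ℂ ((fun z ↦ Omega Γ σ k τ z s) ∘ ofComplex) {w : ℂ | 0 < w.im} := by
  intro w hw
  set z : ℍ := ofComplex w
  obtain ⟨u, hu, hle⟩ := exists_summable_bound hk hτ
    ((isCompact_closedBall z 1).prod (isCompact_singleton (x := s)))
    (fun p hp ↦ by rw [hp.2]; exact hmaj)
  -- Locally uniform convergence is applied on the open hyperbolic unit ball; the bound `u` holds on
  -- its compact closure.
  set U : Set ℂ := ((↑) : ℍ → ℂ) '' Metric.ball z 1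
  have hU : IsOpen U := isOpenEmbedding_coe.isOpenMap _ Metric.isOpen_ball
  have hUim : U ⊆ {w : ℂ | 0 < w.im} := by
    rintro _ ⟨y, -, rfl⟩
    exact y.im_pos
  have hwU : w ∈ U := ⟨z, Metric.mem_ball_self one_pos, by
    simp only [z, ofComplex_apply_of_im_pos hw]⟩
  refine (DifferentiableOn.differentiableAt (s := U) ?_ (hU.mem_nhds hwU)).differentiableWithinAt
  refine Complex.differentiableOn_tsum_of_summable_norm hu
    (F := fun (γ : Γ) w ↦ omegaTerm σ k τ γ (ofComplex w) s)
    (fun γ ↦ (differentiableOn_matrixTerm _ k hτ s).mono hUim) hU ?_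
  rintro γ _ ⟨y, hy, rfl⟩
  rw [ofComplex_apply]
  exact hle γ (y, s) ⟨Metric.ball_subset_closedBall hy, rfl⟩

/-! ### Vanishing at the cusps. -/

/-- Displays the majorant as a product of powers of two real linear forms in `z`. Both exponents are
negative when `0 < r < 2κ`, the reason for the bound `r' < k` in `IsMajorized`. -/
theorem im_rpow_neg_mul_weight_smul (g : SL(2, ℝ)) (κ r t : ℝ) (z : ℍ) :
    z.im ^ (-κ) * weight κ r t (g • z) =
      ‖denom (g : GL (Fin 2) ℝ) z‖ ^ (-(2 * κ - r)) *
        ‖((g 0 0 - t * g 1 0 : ℝ) : ℂ) * z + ((g 0 1 - t * g 1 1 : ℝ) : ℂ)‖ ^ (-r) := by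
  have hd0 : denom (g : GL (Fin 2) ℝ) z ≠ 0 := denom_ne_zero _ z
  have hd : 0 < ‖denom (g : GL (Fin 2) ℝ) z‖ := norm_pos_iff.mpr hd0
  have hq : ((g • z : ℍ) : ℂ) - t = (((g 0 0 - t * g 1 0 : ℝ) : ℂ) * z +
      ((g 0 1 - t * g 1 1 : ℝ) : ℂ)) / denom (g : GL (Fin 2) ℝ) z := by
    rw [coe_SL_smul, div_sub' hd0]
    congr 1
    change ((g 0 0 : ℂ) * z + g 0 1) - ((g 1 0 : ℂ) * z + g 1 1) * t = _
    push_cast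
    ring
  have hz := Real.rpow_pos_of_pos z.im_pos κ
  rw [weight, im_SL_smul, hq, norm_div, Real.div_rpow z.im_pos.le (by positivity),
    Real.div_rpow (norm_nonneg _) hd.le, Real.rpow_neg z.im_pos.le, neg_sub, Real.rpow_sub hd,
    Real.rpow_neg hd.le, ← Real.rpow_natCast, ← Real.rpow_mul hd.le, Nat.cast_ofNat]
  field_simp

theorem norm_linear_of_re_eq_zero (A B : ℝ) {z : ℍ} (hz : z.re = 0) :
    ‖(A : ℂ) * z + B‖ = √(B ^ 2 + (A * z.im) ^ 2) := by
  have h : (A : ℂ) * z + B = (B : ℝ) + ((A * z.im : ℝ) : ℂ) * Complex.I := by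
    apply Complex.ext <;> simp [hz]
  rw [h, Complex.norm_add_mul_I]

theorem norm_linear_le_of_im_le (A B : ℝ) {z w : ℍ} (hz : z.re = 0) (hw : w.re = 0)
    (hzw : z.im ≤ w.im) : ‖(A : ℂ) * z + B‖ ≤ ‖(A : ℂ) * w + B‖ := by
  rw [norm_linear_of_re_eq_zero A B hz, norm_linear_of_re_eq_zero A B hw]
  refine Real.sqrt_le_sqrt ?_
  rw [mul_pow, mul_pow]
  have := z.im_pos
  gcongr

theorem coe_im_le_norm_linear (A B : ℝ) (z : ℍ) : |A| * z.im ≤ ‖(A : ℂ) * z + B‖ := by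
  have h := Complex.abs_im_le_norm ((A : ℂ) * z + B)
  simpa [abs_mul, abs_of_pos z.im_pos] using h

theorem norm_linear_pos {A B : ℝ} (h : A ≠ 0 ∨ B ≠ 0) (z : ℍ) : 0 < ‖(A : ℂ) * z + B‖ := by
  refine norm_pos_iff.mpr (linear_ne_zero (cd := ![A, B]) z fun h0 ↦ ?_)
  have h1 : A = 0 := congrFun h0 0
  have h2 : B = 0 := congrFun h0 1
  simp_all

/-- The point `i Im(z)`. -/
def vert (z : ℍ) : ℍ := ⟨z.im * Complex.I, by simpa using z.im_pos⟩

@[simp] theorem vert_im (z : ℍ) : (vert z).im = z.im := by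
  simp [vert, ← coe_im]

@[simp] theorem vert_re (z : ℍ) : (vert z).re = 0 := by
  simp [vert, ← coe_re]

theorem det_rows (g : SL(2, ℝ)) : g 0 0 * g 1 1 - g 0 1 * g 1 0 = 1 := by
  have := g.det_coe
  rwa [Matrix.det_fin_two] at this

/-- On the imaginary axis `|Aiy + B|² = B² + A²y²` grows with `y`, so the value at `I` dominates all
higher ones. -/
theorem weight_vert_le (g : SL(2, ℝ)) {κ r : ℝ} (hr : 0 ≤ r) (hκ : r ≤ 2 * κ) (t : ℝ) {z : ℍ}
    (hz : 1 ≤ z.im) :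
    (vert z).im ^ (-κ) * weight κ r t (g • vert z) ≤ weight κ r t (g • I) := by
  have hI : weight κ r t (g • I) = I.im ^ (-κ) * weight κ r t (g • I) := by simp
  have hdet := det_rows g
  rw [hI, im_rpow_neg_mul_weight_smul, im_rpow_neg_mul_weight_smul]
  have hIre : I.re = 0 := by simp
  have him : I.im ≤ (vert z).im := by simpa using hz
  refine mul_le_mul (Real.rpow_le_rpow_of_nonpos ?_ ?_ (by linarith))
    (Real.rpow_le_rpow_of_nonpos ?_ ?_ (by linarith)) (by positivity) (by positivity)
  · exact norm_pos_iff.mpr (denom_ne_zero _ _)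
  · exact norm_linear_le_of_im_le _ _ hIre (vert_re z) him
  · refine norm_linear_pos ?_ I
    by_contra! h
    have h1 : g 0 0 = t * g 1 0 := by linarith [h.1]
    have h2 : g 0 1 = t * g 1 1 := by linarith [h.2]
    rw [h1, h2] at hdet
    linarith
  · exact norm_linear_le_of_im_le _ _ hIre (vert_re z) him

theorem tendsto_norm_linear_rpow {A : ℝ} (hA : A ≠ 0) (B : ℝ) {e : ℝ} (he : 0 < e) :
    Tendsto (fun z : ℍ ↦ ‖(A : ℂ) * (vert z : ℍ) + B‖ ^ (-e)) atImInfty (𝓝 0) := by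
  refine (tendsto_rpow_neg_atTop he).comp ?_
  refine tendsto_atTop_mono (fun z ↦ coe_im_le_norm_linear A B (vert z)) ?_
  simp only [vert_im]
  exact tendsto_comap.const_mul_atTop (abs_pos.mpr hA)

theorem tendsto_weight_vert (g : SL(2, ℝ)) {κ r : ℝ} (hr : 0 < r) (hκ : r < 2 * κ) (t : ℝ) :
    Tendsto (fun z : ℍ ↦ (vert z).im ^ (-κ) * weight κ r t (g • vert z)) atImInfty (𝓝 0) := by
  have hdet := det_rows g
  have him : ∀ᶠ z : ℍ in atImInfty, I.im ≤ (vert z).im := by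
    simp only [vert_im, I_im]
    exact tendsto_comap.eventually_ge_atTop 1
  have hbound : ∀ {A B : ℝ}, (A ≠ 0 ∨ B ≠ 0) → ∀ {e : ℝ}, 0 < e → ∀ᶠ z : ℍ in atImInfty,
      ‖(A : ℂ) * (vert z : ℍ) + B‖ ^ (-e) ≤ ‖(A : ℂ) * (I : ℍ) + B‖ ^ (-e) := by
    intro A B hAB e he
    filter_upwards [him] with z hz
    exact Real.rpow_le_rpow_of_nonpos (norm_linear_pos hAB I)
      (norm_linear_le_of_im_le _ _ (by simp) (vert_re z) hz) (by linarith)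
  simp only [im_rpow_neg_mul_weight_smul]
  have hden : ∀ z : ℍ, denom (g : GL (Fin 2) ℝ) z = (g 1 0 : ℂ) * z + g 1 1 := fun z ↦ rfl
  simp only [hden]
  -- By the determinant the two forms cannot both lack a `z` term. One that has it tends to
  -- infinity, while the other stays at least its modulus at `I`.
  by_cases hc : g 1 0 = 0
  · have ha : g 0 0 - t * g 1 0 ≠ 0 := by
      intro h
      rw [hc] at h hdet
      simp at h
      rw [h] at hdet
      simp at hdet
    have h11 : g 1 1 ≠ 0 := by
      intro h
      rw [hc, h] at hdet
      simp at hdet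
    have h1 := (tendsto_norm_linear_rpow ha (g 0 1 - t * g 1 1) hr).const_mul
      (‖(g 1 0 : ℂ) * (I : ℍ) + (g 1 1 : ℝ)‖ ^ (-(2 * κ - r)))
    rw [mul_zero] at h1
    refine tendsto_of_tendsto_of_tendsto_of_le_of_le' tendsto_const_nhds h1
      (Eventually.of_forall fun z ↦ by positivity) ?_
    filter_upwards [hbound (A := g 1 0) (B := g 1 1) (Or.inr h11) (sub_pos.mpr hκ)] with z hz
    exact mul_le_mul_of_nonneg_right hz (by positivity)
  · have hne : g 0 0 - t * g 1 0 ≠ 0 ∨ g 0 1 - t * g 1 1 ≠ 0 := by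
      by_contra! h
      have h1 : g 0 0 = t * g 1 0 := by linarith [h.1]
      have h2 : g 0 1 = t * g 1 1 := by linarith [h.2]
      rw [h1, h2] at hdet
      linarith
    have h1 := (tendsto_norm_linear_rpow hc (g 1 1) (sub_pos.mpr hκ)).mul_const
      (‖((g 0 0 - t * g 1 0 : ℝ) : ℂ) * (I : ℍ) + ((g 0 1 - t * g 1 1 : ℝ) : ℂ)‖ ^ (-r))
    rw [zero_mul] at h1
    refine tendsto_of_tendsto_of_tendsto_of_le_of_le' tendsto_const_nhds h1
      (Eventually.of_forall fun z ↦ by positivity) ?_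
    filter_upwards [hbound hne hr] with z hz
    exact mul_le_mul_of_nonneg_left hz (by positivity)

theorem dist_vert_le (z : ℍ) : dist z (vert z) ≤ |z.re| / z.im := by
  refine (dist_le_dist_coe_div_sqrt z (vert z)).trans (le_of_eq ?_)
  have h : (z : ℂ) - (vert z : ℍ) = (z.re : ℝ) := by
    apply Complex.ext <;> simp
  rw [vert_im, Real.sqrt_mul_self z.im_pos.le, dist_eq_norm, h, Complex.norm_real,
    Real.norm_eq_abs]

theorem exists_vadd_abs_re_le {x : ℝ} (hx : x ≠ 0) (z : ℍ) :
    ∃ n : ℤ, |(((n * x : ℝ)) +ᵥ z).re| ≤ |x| := by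
  refine ⟨-⌊z.re / x⌋, ?_⟩
  have h : ((-⌊z.re / x⌋ : ℤ) * x : ℝ) + z.re = Int.fract (z.re / x) * x := by
    rw [Int.fract]; push_cast; field_simp; ring
  rw [vadd_re, h, abs_mul, abs_of_nonneg (Int.fract_nonneg _)]
  exact mul_le_of_le_one_left (abs_nonneg x) (Int.fract_lt_one _).le

theorem isZeroAt_Omega {Γ : Subgroup PSL(2, ℝ)} {σ : SL(2, ℝ)} {k : ℤ} (hke : Even k)
    {τ : ℂ} (hτ : 0 ≤ τ.im) {s : ℂ} (hmaj : IsMajorized Γ σ k τ s.re)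
    {c : OnePoint ℝ} (hc : IsCuspOf Γ c) : c.IsZeroAt (fun z ↦ Omega Γ σ k τ z s) k := by
  obtain ⟨ρ, hρ⟩ := exists_SL_smul_infty_eq c
  rw [OnePoint.isZeroAt_iff hρ]
  obtain ⟨p, hp, x, hx, hpx⟩ := hc.exists_translation hρ
  set F : ℍ → ℂ := fun z ↦ Omega Γ σ k τ z s with hF
  set φ := F ∣[k] (ρ : GL (Fin 2) ℝ) with hφ
  have hper : ∀ z, φ (x +ᵥ z) = φ z := by
    intro z
    have h1 : φ ∣[k] Matrix.GeneralLinearGroup.upperRightHom x = φ := by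
      rw [hφ, ← SlashAction.slash_mul, ← hpx, SlashAction.slash_mul, hF,
        Omega_slash_of_mem hke τ s hp]
    conv_rhs => rw [← h1]
    rw [ModularForm.slash_apply, upperRightHom_smul]
    simp [UpperHalfPlane.σ, denom]
  -- Periodicity brings `z` to `|Re z| ≤ |x|`; for `Im z ≥ 1` it is then within hyperbolic distance
  -- `|x|` of `vert z`.
  have hperZ : ∀ (n : ℤ) (z : ℍ), φ ((n * x : ℝ) +ᵥ z) = φ z := by
    intro n
    induction n using Int.induction_on with
    | zero => intro z; simp
    | succ n ih =>
      intro z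
      rw [← ih z, ← hper ((n : ℤ) * x +ᵥ z), vadd_vadd]
      congr 2
      push_cast; ring
    | pred n ih =>
      intro z
      rw [← ih z, ← hper, vadd_vadd]
      congr 2
      push_cast; ring
  obtain ⟨r, C, hr, hrk, hC, hle, hs⟩ := hmaj
  set κ : ℝ := k / 2 with hκ
  have hrκ : r < 2 * κ := by rw [hκ]; linarith
  have hκ0 : 0 ≤ κ := by linarith
  set A : Γ → SL(2, ℝ) := fun γ ↦ σ⁻¹ * outLift γ * ρ with hA
  set E := Real.exp (Real.pi * |s.im|) * C * Real.exp ((κ + r) * |x|) with hE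
  have hsum : Summable fun γ : Γ ↦ weight κ r τ.re (A γ • I) := by
    refine ((hs (ρ • I)).comp_injective (outLift_injective Γ)).congr fun γ ↦ ?_
    simp only [Function.comp_apply, hA, mul_smul]
  have hterm : ∀ z : ℍ, 1 ≤ z.im → |z.re| ≤ |x| → ∀ γ : Γ, ‖matrixTerm (A γ) k τ z s‖ ≤
      E * ((vert z).im ^ (-κ) * weight κ r τ.re (A γ • vert z)) := by
    intro z hz hzx γ
    have hd : dist (A γ • z) (A γ • vert z) ≤ |x| := by
      rw [dist_smul]
      exact (dist_vert_le z).trans ((div_le_self (abs_nonneg _) hz).trans hzx)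
    have hw := weight_le_exp_mul hκ0 hr.le τ.re hd
    have hz0 := z.im_pos
    have h0 := (A γ • z).im_pos
    calc ‖matrixTerm (A γ) k τ z s‖
        ≤ Real.exp (Real.pi * |s.im|) * z.im ^ (-κ) *
          ((A γ • z).im ^ κ * ‖((A γ • z : ℍ) : ℂ) - conj τ‖ ^ (-s.re)) :=
          norm_matrixTerm_le _ k hτ z s
      _ ≤ Real.exp (Real.pi * |s.im|) * z.im ^ (-κ) *
          ((A γ • z).im ^ κ * (C * ‖((A γ • z : ℍ) : ℂ) - τ.re‖ ^ (-r))) := by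
          gcongr
          exact hle _
      _ = Real.exp (Real.pi * |s.im|) * C * z.im ^ (-κ) * weight κ r τ.re (A γ • z) := by
          rw [weight]; ring
      _ ≤ Real.exp (Real.pi * |s.im|) * C * z.im ^ (-κ) *
          (Real.exp ((κ + r) * |x|) * weight κ r τ.re (A γ • vert z)) := by
          gcongr
      _ = _ := by rw [hE, vert_im]; ring
  have hsumz : ∀ z : ℍ, 1 ≤ z.im →
      Summable fun γ : Γ ↦ (vert z).im ^ (-κ) * weight κ r τ.re (A γ • vert z) := fun z hz ↦
    hsum.of_nonneg_of_le
      (fun γ ↦ mul_nonneg (Real.rpow_nonneg (vert z).im_pos.le _) (weight_pos _ _ _ _).le)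
      fun γ ↦ weight_vert_le _ hr.le hrκ.le τ.re hz
  have hφle : ∀ z : ℍ, 1 ≤ z.im →
      ‖φ z‖ ≤ E * ∑' γ : Γ, (vert z).im ^ (-κ) * weight κ r τ.re (A γ • vert z) := by
    intro z hz
    obtain ⟨n, hn⟩ := exists_vadd_abs_re_le hx z
    set z' := (n * x : ℝ) +ᵥ z with hz'
    have him : z'.im = z.im := vadd_im _ _
    have hv : vert z' = vert z := by ext; simp [vert, him]
    have h1 := hterm z' (by rw [him]; exact hz) hn
    rw [hv] at h1
    rw [← hperZ n z, ← hz', hφ, hF, Omega_slash_apply, ← tsum_mul_left]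
    exact tsum_of_norm_bounded ((hsumz z hz).mul_left E).hasSum h1
  -- Dominated convergence, with the summable values at `I` as majorant.
  have hlim : Tendsto (fun z : ℍ ↦ ∑' γ : Γ, (vert z).im ^ (-κ) * weight κ r τ.re (A γ • vert z))
      atImInfty (𝓝 (∑' _ : Γ, (0 : ℝ))) := by
    refine tendsto_tsum_of_dominated_convergence hsum
      (fun γ ↦ tendsto_weight_vert (A γ) hr hrκ τ.re) ?_
    filter_upwards [tendsto_comap.eventually_ge_atTop 1] with z hz γ
    rw [Real.norm_of_nonneg
      (mul_nonneg (Real.rpow_nonneg (vert z).im_pos.le _) (weight_pos _ _ _ _).le)]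
    exact weight_vert_le _ hr.le hrκ.le τ.re hz
  rw [tsum_zero] at hlim
  have hlim' := hlim.const_mul E
  rw [mul_zero] at hlim'
  refine squeeze_zero_norm' ?_ hlim'
  filter_upwards [tendsto_comap.eventually_ge_atTop 1] with z hz
  exact hφle z hz

theorem isCuspFormFor_Omega {Γ : Subgroup PSL(2, ℝ)} {σ : SL(2, ℝ)} {k : ℤ} (hk : 0 < k)
    (hke : Even k) {τ : ℂ} (hτ : 0 ≤ τ.im) {s : ℂ} (hmaj : IsMajorized Γ σ k τ s.re) :
    IsCuspFormFor Γ k fun z ↦ Omega Γ σ k τ z s :=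
  ⟨{ toFun := fun z ↦ Omega Γ σ k τ z s
     slash_action_eq' := by
      rintro _ ⟨g, hg, rfl⟩
      exact Omega_slash_of_mem hke τ s hg
     holo' := mdifferentiable_iff.mpr (differentiableOn_Omega hk hτ hmaj)
     zero_at_cusps' := fun hc ↦ isZeroAt_Omega hke hτ hmaj hc }, fun _ ↦ rfl⟩

/-! ### The three kinds of parameter. -/

/-- Since `|w - τ̄|` is at least both `Im τ` and `|w - Re τ|`, the exponent `r` can be lowered to
some `r'` with `1 < r' < k/2`, at the cost of a constant. -/
theorem isMajorized_of_pos_im {Γ : Subgroup PSL(2, ℝ)} [DiscreteTopology (liftSL Γ)]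
    {a : OnePoint ℝ} (ha : IsCuspOf Γ a) {σ : SL(2, ℝ)}
    (hσ : (σ : GL (Fin 2) ℝ) • (OnePoint.infty : OnePoint ℝ) = a) {k : ℤ} (hk : 2 < k) {τ : ℂ}
    (hτ : 0 < τ.im) {r : ℝ} (hr : 1 < r) : IsMajorized Γ σ k τ r := by
  have hk' : (2 : ℝ) < k := by exact_mod_cast hk
  obtain ⟨r', h1, h2⟩ := exists_between (lt_min hr (by linarith : (1 : ℝ) < k / 2))
  obtain ⟨h2, h3⟩ := lt_min_iff.mp h2
  refine ⟨r', τ.im ^ (r' - r), by linarith, by linarith, by positivity, fun w ↦ ?_, fun z ↦ ?_⟩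
  · have hτw : τ.im ≤ ‖(w : ℂ) - conj τ‖ := by
      have h4 := Complex.abs_im_le_norm ((w : ℂ) - conj τ)
      simp only [Complex.sub_im, Complex.conj_im, coe_im, sub_neg_eq_add] at h4
      linarith [le_abs_self (w.im + τ.im), w.im_pos]
    have hw0 : 0 < ‖(w : ℂ) - conj τ‖ := hτ.trans_le hτw
    have hle : ‖(w : ℂ) - τ.re‖ ≤ ‖(w : ℂ) - conj τ‖ := by
      rw [Complex.norm_eq_sqrt_sq_add_sq, Complex.norm_eq_sqrt_sq_add_sq]
      refine Real.sqrt_le_sqrt ?_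
      simp only [Complex.sub_re, Complex.sub_im, Complex.ofReal_re, Complex.ofReal_im,
        Complex.conj_re, Complex.conj_im, coe_im, coe_re]
      have := w.im_pos
      nlinarith
    calc ‖(w : ℂ) - conj τ‖ ^ (-r)
        = ‖(w : ℂ) - conj τ‖ ^ (r' - r) * ‖(w : ℂ) - conj τ‖ ^ (-r') := by
          rw [← Real.rpow_add hw0]; congr 1; ring
      _ ≤ τ.im ^ (r' - r) * ‖(w : ℂ) - τ.re‖ ^ (-r') :=
          mul_le_mul (Real.rpow_le_rpow_of_nonpos hτ hτw (by linarith))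
            (Real.rpow_le_rpow_of_nonpos (norm_sub_ofReal_pos w _) hle (by linarith))
            (by positivity) (by positivity)
  · obtain ⟨V, hV, hG⟩ := ha.exists_im_orbit_le hσ z
    exact summable_weight_orbit _ σ⁻¹ z hV hG h1 h3 τ.re

theorem isMajorized_ofReal {Γ : Subgroup PSL(2, ℝ)} [DiscreteTopology (liftSL Γ)]
    {a : OnePoint ℝ} (ha : IsCuspOf Γ a) {σ : SL(2, ℝ)}
    (hσ : (σ : GL (Fin 2) ℝ) • (OnePoint.infty : OnePoint ℝ) = a) {k : ℤ} (τ : ℝ)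
    {r : ℝ} (hr : 1 < r) (hrk : r < (k : ℝ) / 2) : IsMajorized Γ σ k τ r := by
  refine ⟨r, 1, by linarith, by linarith, zero_le_one, fun w ↦ by simp, fun z ↦ ?_⟩
  obtain ⟨V, hV, hG⟩ := ha.exists_im_orbit_le hσ z
  exact summable_weight_orbit _ σ⁻¹ z hV hG hr hrk _

/-- The height bound at the cusp `στ`, read through `σ * toReal τ`, is the horoball condition at
`τ`; with `κ = k/2` the limit `2κ - 1` is `k - 1`. -/
theorem isMajorized_ofReal_of_isCuspOf {Γ : Subgroup PSL(2, ℝ)} [DiscreteTopology (liftSL Γ)]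
    {a : OnePoint ℝ} (ha : IsCuspOf Γ a) {σ : SL(2, ℝ)}
    (hσ : (σ : GL (Fin 2) ℝ) • (OnePoint.infty : OnePoint ℝ) = a) {k : ℤ} {τ : ℝ}
    (hτ : IsCuspOf Γ ((σ : GL (Fin 2) ℝ) • (τ : OnePoint ℝ)))
    {r : ℝ} (hr : 1 < r) (hrk : r < (k : ℝ) - 1) : IsMajorized Γ σ k τ r := by
  refine ⟨r, 1, by linarith, by linarith, zero_le_one, fun w ↦ by simp, fun z ↦ ?_⟩
  obtain ⟨V, hV, hG⟩ := ha.exists_im_orbit_le hσ z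
  have hρ : ((σ * toReal τ : SL(2, ℝ)) : GL (Fin 2) ℝ) • (OnePoint.infty : OnePoint ℝ) =
      (σ : GL (Fin 2) ℝ) • (τ : OnePoint ℝ) := by
    rw [map_mul, mul_smul, toReal_smul_infty]
  obtain ⟨C, hC, hG'⟩ := hτ.exists_im_orbit_le hρ z
  refine summable_weight_orbit_of_horoball _ σ⁻¹ z hV hG _ hC (fun g hg ↦ ?_) hr (by linarith)
  have h := hG' g hg
  rw [mul_inv_rev, mul_smul, im_toReal_inv_smul,
    div_le_iff₀ (pow_pos (norm_sub_ofReal_pos _ _) 2)] at h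
  exact h

end

end CuspKernel

theorem proposition5p1 (Γ : Subgroup PSL(2, ℝ)) (hΓ : CuspKernel.IsFuchsianFirstKind Γ)
    (a : OnePoint ℝ) (ha : CuspKernel.IsCuspOf Γ a)
    (σ : SL(2, ℝ)) (hσ : CuspKernel.IsScalingMatrix Γ a σ)
    (k : ℤ) (hk : Even k) (hk2 : 2 < k) :
    -- the case of a parameter in the upper half-plane
    (∀ τ : ℍ,
      CuspKernel.ConvergesAbsolutelyUniformly Γ σ k (τ : ℂ) {s : ℂ | 1 < s.re} ∧
      ∀ s : ℂ, 1 < s.re → s.re < (k : ℝ) + 1 →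
        CuspKernel.IsCuspFormFor Γ k fun z ↦ CuspKernel.Omega Γ σ k (τ : ℂ) z s) ∧
    -- the case of a real parameter
    (∀ τ : ℝ,
      CuspKernel.ConvergesAbsolutelyUniformly Γ σ k (τ : ℂ)
        {s : ℂ | 1 < s.re ∧ s.re < (k : ℝ) / 2} ∧
      ∀ s : ℂ, 1 < s.re → s.re < (k : ℝ) / 2 →
        CuspKernel.IsCuspFormFor Γ k fun z ↦ CuspKernel.Omega Γ σ k (τ : ℂ) z s) ∧
    -- the case of a real parameter that `σ` maps to a cusp
    (∀ τ : ℝ, CuspKernel.IsCuspOf Γ ((σ : GL (Fin 2) ℝ) • (τ : OnePoint ℝ)) →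
      CuspKernel.ConvergesAbsolutelyUniformly Γ σ k (τ : ℂ)
        {s : ℂ | 1 < s.re ∧ s.re < (k : ℝ) - 1} ∧
      ∀ s : ℂ, 1 < s.re → s.re < (k : ℝ) - 1 →
        CuspKernel.IsCuspFormFor Γ k fun z ↦ CuspKernel.Omega Γ σ k (τ : ℂ) z s) := by
  have : DiscreteTopology (CuspKernel.liftSL Γ) := hΓ.discrete
  have hσa := hσ.map_infty
  have hk0 : 0 < k := by omega
  refine ⟨fun τ ↦ ?_, fun τ ↦ ?_, fun τ hτ ↦ ?_⟩
  · have hmaj : ∀ s : ℂ, 1 < s.re → CuspKernel.IsMajorized Γ σ k (τ : ℂ) s.re := fun s hs ↦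
      CuspKernel.isMajorized_of_pos_im ha hσa hk2 τ.im_pos hs
    exact ⟨CuspKernel.convergesAbsolutelyUniformly_of_isMajorized hk0 τ.im_pos.le hmaj,
      fun s hs _ ↦ CuspKernel.isCuspFormFor_Omega hk0 hk τ.im_pos.le (hmaj s hs)⟩
  · have hmaj : ∀ s : ℂ, 1 < s.re ∧ s.re < (k : ℝ) / 2 →
        CuspKernel.IsMajorized Γ σ k (τ : ℂ) s.re := fun s hs ↦
      CuspKernel.isMajorized_ofReal ha hσa τ hs.1 hs.2
    exact ⟨CuspKernel.convergesAbsolutelyUniformly_of_isMajorized hk0 (by simp) hmaj,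
      fun s hs hs' ↦ CuspKernel.isCuspFormFor_Omega hk0 hk (by simp) (hmaj s ⟨hs, hs'⟩)⟩
  · have hmaj : ∀ s : ℂ, 1 < s.re ∧ s.re < (k : ℝ) - 1 →
        CuspKernel.IsMajorized Γ σ k (τ : ℂ) s.re := fun s hs ↦
      CuspKernel.isMajorized_ofReal_of_isCuspOf ha hσa hτ hs.1 hs.2
    exact ⟨CuspKernel.convergesAbsolutelyUniformly_of_isMajorized hk0 (by simp) hmaj,
      fun s hs hs' ↦ CuspKernel.isCuspFormFor_Omega hk0 hk (by simp) (hmaj s ⟨hs, hs'⟩)⟩
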